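/- Let $\mathcal R,\mathcal S,\mathcal T$ be small preadditive categories. Write $\mathcal R\text{-}\mathrm{Mod}$ (respectively $\mathrm{Mod}\text{-}\mathcal R$) for the category of left (respectively right) $\mathcal R$-modules, i.e. additive functors $\mathcal R\to\mathbf{Ab}$ (respectively $\mathcal R^{\mathrm{op}}\to\mathbf{Ab}$), and similarly for $\mathcal S,\mathcal T$. For $N\in\mathrm{Mod}\text{-}\mathcal R$ let $N\otimes_{\mathcal R}-:\mathcal R\text{-}\mathrm{Mod}\to\mathbf{Ab}$ be the tensor product functor. For an accessible functor $F:\mathcal R\text{-}\mathrm{Mod}\to\mathcal S\text{-}\mathrm{Mod}$, i.e. one which preserves $\lambda$-directed colimits for some regular cardinal $\lambda$, its Auslander–Gruson–Jensen dual is the functor $DF:\mathrm{Mod}\text{-}\mathcal R\to\mathrm{Mod}\text{-}\mathcal S$ given by $$((DF)N)(S)=\mathrm{Nat}\bigl((F-)(S),\,N\otimes_{\mathcal R}-\bigr)\qquad(N\in\mathrm{Mod}\text{-}\mathcal R,\ S\in\mathcal S),$$ the (small) abelian group of natural transformations between functors $\mathcal R\text{-}\mathrm{Mod}\to\mathbf{Ab}$.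 Corollary. Let $F:\mathcal R\text{-}\mathrm{Mod}\to\mathcal S\text{-}\mathrm{Mod}$ and $G:\mathcal S\text{-}\mathrm{Mod}\to\mathcal T\text{-}\mathrm{Mod}$ be additive functors which preserve directed colimits, and suppose that $F$ also preserves products. Then there is an isomorphism of functors $\mathrm{Mod}\text{-}\mathcal R\to\mathrm{Mod}\text{-}\mathcal T$ $$(DG)(DF)\;\simeq\;D(GF).$$ -/

import Mathlib

open CategoryTheory Limits Opposite
universe u
noncomputable section
namespace AGJ

/-- Left modules over a small preadditive category `R`: additive functors `R ⥤ Ab`. -/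
abbrev LeftMod (R : Type u) [SmallCategory R] [Preadditive R] : Type (u + 1) :=
  R ⥤+ AddCommGrpCat.{u}

/-- Right modules over a small preadditive category `R`: additive functors `Rᵒᵖ ⥤ Ab`. -/
abbrev RightMod (R : Type u) [SmallCategory R] [Preadditive R] : Type (u + 1) :=
  Rᵒᵖ ⥤+ AddCommGrpCat.{u}

/-- The functor `F` preserves directed colimits, i.e. colimits of diagrams indexed by small
non-empty directed posets. -/
class PreservesDirectedColimits {C D : Type (u + 1)} [Category.{u} C] [Category.{u} D]
    (F : C ⥤ D) : Prop where
  preserves (J : Type u) [PartialOrder J] [IsDirected J (· ≤ ·)] [Nonempty J] :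
    PreservesColimitsOfShape J F

attribute [local instance] Cardinal.fact_isRegular_aleph0 in
instance isAccessible_of_preservesDirectedColimits {C D : Type (u + 1)} [Category.{u} C]
    [Category.{u} D] (F : C ⥤ D) [PreservesDirectedColimits F] :
    Functor.IsAccessible.{u} F := by
  suffices F.IsCardinalAccessible Cardinal.aleph0.{u} from
    ⟨⟨_, _, this⟩⟩
  refine ⟨fun J _ _ ↦ ?_⟩
  obtain ⟨α, _, _, H, _⟩ := IsCardinalFiltered.exists_cardinal_directed J Cardinal.aleph0.{u}
  have := isFiltered_of_isCardinalFiltered α Cardinal.aleph0.{u}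
  have : IsDirected α (· ≤ ·) := ⟨fun a b ↦
    ⟨IsFiltered.max a b, leOfHom (IsFiltered.leftToMax a b), leOfHom (IsFiltered.rightToMax a b)⟩⟩
  have : Nonempty α := IsFiltered.nonempty
  have := PreservesDirectedColimits.preserves (F := F) α
  exact Functor.Final.preservesColimitsOfShape_of_final H F

instance {C D E : Type (u + 1)} [Category.{u} C] [Category.{u} D] [Category.{u} E]
    (F : C ⥤ D) (G : D ⥤ E) [PreservesDirectedColimits F] [PreservesDirectedColimits G] :
    PreservesDirectedColimits (F ⋙ G) where
  preserves J _ _ _ := by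
    have := PreservesDirectedColimits.preserves (F := F) J
    have := PreservesDirectedColimits.preserves (F := G) J
    infer_instance

section
variable (R : Type u) [SmallCategory R] [Preadditive R]

instance isClosedUnderColimits_additiveFunctor (J : Type u) [SmallCategory J] :
    (additiveFunctor R AddCommGrpCat.{u}).IsClosedUnderColimitsOfShape J where
  colimitsOfShape_le := by
    rintro X ⟨h⟩
    refine ⟨fun {r s f g} ↦ ?_⟩
    refine (isColimitOfPreserves ((evaluation _ _).obj r) h.isColimit).hom_ext fun j ↦ ?_
    have : (h.diag.obj j).Additive := h.prop_diag_obj j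
    have hn := fun f : r ⟶ s ↦ (h.ι.app j).naturality f
    dsimp at hn ⊢
    rw [Preadditive.comp_add, ← hn, ← hn, ← hn, Functor.map_add, Preadditive.add_comp]

instance : HasColimitsOfSize.{u, u} (LeftMod R) where
  has_colimits_of_shape _ _ := inferInstance

variable {R} in
/-- The functor `M ↦ M(r)`. -/
abbrev evalAt (r : R) : LeftMod R ⥤ AddCommGrpCat.{u} :=
  AdditiveFunctor.forget R AddCommGrpCat.{u} ⋙ (evaluation _ _).obj r

instance (r : R) : PreservesColimitsOfSize.{u, u} (evalAt r) where
  preservesColimitsOfShape := inferInstance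

variable {R} in
/-- The representable left module `Hom(r, -)`. -/
def repr (r : R) : LeftMod R := AdditiveFunctor.of (preadditiveCoyoneda.obj (op r))

variable {R} in
/-- The Yoneda bijection `Hom(Hom(r, -), M) ≃ M(r)`. -/
def reprEquiv (r : R) (M : LeftMod R) : (repr r ⟶ M) ≃ M.obj.obj r where
  toFun φ := φ.hom.app r (𝟙 r)
  invFun x := ObjectProperty.homMk
    { app s := AddCommGrpCat.ofHom
        { toFun := fun f : r ⟶ s ↦ M.obj.map f x
          map_zero' := by
            change M.obj.map (0 : r ⟶ s) x = 0
            rw [Functor.map_zero]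
            rfl
          map_add' f g := by
            exact ConcreteCategory.congr_hom (M.obj.map_add (f := (f : r ⟶ s)) (g := g)) x }
      naturality s t f := by
        ext (g : r ⟶ s)
        exact ConcreteCategory.congr_hom (M.obj.map_comp g f) x }
  left_inv φ := by
    ext s (f : r ⟶ s)
    have := ConcreteCategory.congr_hom (φ.hom.naturality f) (𝟙 r)
    refine this.symm.trans ?_
    change φ.hom.app s (𝟙 r ≫ f) = _
    rw [Category.id_comp]
  right_inv x := by
    change M.obj.map (𝟙 r) x = x
    simp

instance (r : R) (κ : Cardinal.{u}) [Fact κ.IsRegular] : IsCardinalPresentable (repr r) κ where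
  preservesColimitOfShape J _ hJ := by
    have := isFiltered_of_isCardinalFiltered J κ
    let e : evalAt r ⋙ CategoryTheory.forget AddCommGrpCat.{u} ≅ coyoneda.obj (op (repr r)) :=
      NatIso.ofComponents (fun M ↦ (reprEquiv r M).symm.toIso) (fun {M N} f ↦ by
        rw [← Iso.inv_comp_eq, ← Category.assoc, ← Iso.eq_comp_inv]
        rfl)
    exact preservesColimitsOfShape_of_natIso e

lemma isStrongGenerator_repr :
    (ObjectProperty.ofObj (fun r : R ↦ repr r)).IsStrongGenerator := by
  rw [ObjectProperty.isStrongGenerator_iff]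
  refine ⟨fun M N f g h ↦ ?_, fun M N i _ hi ↦ ?_⟩
  · ext r x
    have := h (repr r) (ObjectProperty.ofObj_apply _ r) ((reprEquiv r M).symm x)
    have := congrArg (reprEquiv r N) this
    change f.hom.app r (M.obj.map (𝟙 r) x) = g.hom.app r (M.obj.map (𝟙 r) x) at this
    simpa using this
  · have key : ∀ r, IsIso (i.hom.app r) := fun r ↦ by
      rw [ConcreteCategory.isIso_iff_bijective]
      constructor
      · intro x y hxy
        apply (reprEquiv r M).symm.injective
        rw [← cancel_mono i]
        apply (reprEquiv r N).injective
        change i.hom.app r (M.obj.map (𝟙 r) x) = i.hom.app r (M.obj.map (𝟙 r) y)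
        simpa using hxy
      · intro y
        obtain ⟨f, hf⟩ := hi (repr r) (ObjectProperty.ofObj_apply _ r) ((reprEquiv r N).symm y)
        refine ⟨reprEquiv r M f, ?_⟩
        have := congrArg (reprEquiv r N) hf
        rw [Equiv.apply_symm_apply] at this
        exact this
    have : IsIso i.hom := NatTrans.isIso_iff_isIso_app _ |>.2 key
    have : IsIso ((AdditiveFunctor.forget R AddCommGrpCat.{u}).map i) := this
    exact isIso_of_reflects_iso i (AdditiveFunctor.forget R AddCommGrpCat.{u})

instance (κ : Cardinal.{u}) [Fact κ.IsRegular] : IsCardinalLocallyPresentable (LeftMod R) κ := by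
  rw [IsCardinalLocallyPresentable.iff_exists_isStrongGenerator]
  refine ⟨_, inferInstance, isStrongGenerator_repr R, ?_⟩
  rintro _ ⟨r⟩
  rw [isCardinalPresentable_iff]
  infer_instance

variable {R} in
/-- Natural transformations out of an accessible functor form a (small) set. -/
instance small_natTrans (Φ Ψ : LeftMod R ⥤ AddCommGrpCat.{u}) [Functor.IsAccessible.{u} Φ] :
    Small.{u} (Φ ⟶ Ψ) := by
  obtain ⟨κ, _, _⟩ := Functor.IsAccessible.exists_cardinal (F := Φ)
  obtain ⟨P, _, hP⟩ := HasCardinalFilteredGenerator.exists_small_generator (LeftMod R) κ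
  refine small_of_injective (β := ∀ M : Subtype P, Φ.obj M.1 ⟶ Ψ.obj M.1)
    (f := fun α M ↦ α.app M.1) fun α β h ↦ ?_
  ext1
  ext1 M
  obtain ⟨J, _, _, ⟨p⟩⟩ := hP.exists_colimitsOfShape M
  have := Φ.preservesColimitsOfShape_of_isCardinalAccessible κ J
  refine (isColimitOfPreserves Φ p.isColimit).hom_ext fun j ↦ ?_
  have hj := congrFun h ⟨_, p.prop_diag_obj j⟩
  dsimp at hj ⊢
  rw [α.naturality, β.naturality, hj]

end

section Tensor

open scoped TensorProduct DirectSum Classical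

variable {R : Type u} [SmallCategory R] [Preadditive R]

/-- The direct sum of the abelian groups `N(r) ⊗ M(r)`. -/
abbrev TensorSum (N : RightMod R) (M : LeftMod R) : Type u :=
  ⨁ r : R, (N.obj.obj (op r) ⊗[ℤ] M.obj.obj r)

/-- The elements `n f ⊗ m - n ⊗ f m`, for `f : r ⟶ s`, `n ∈ N(s)` and `m ∈ M(r)`. -/
def tensorRelations (N : RightMod R) (M : LeftMod R) : Set (TensorSum N M) :=
  {z | ∃ (r s : R) (f : r ⟶ s) (n : N.obj.obj (op s)) (m : M.obj.obj r),
    z = DirectSum.of (fun r : R ↦ (N.obj.obj (op r) ⊗[ℤ] M.obj.obj r)) r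
          (N.obj.map f.op n ⊗ₜ[ℤ] m) -
        DirectSum.of (fun r : R ↦ (N.obj.obj (op r) ⊗[ℤ] M.obj.obj r)) s
          (n ⊗ₜ[ℤ] M.obj.map f m)}

/-- The tensor product `N ⊗_R M`: the quotient of `⨁ r, N(r) ⊗ M(r)` by the relations
`n f ⊗ m = n ⊗ f m`. -/
def tensorObj (N : RightMod R) (M : LeftMod R) : AddCommGrpCat.{u} :=
  AddCommGrpCat.of (TensorSum N M ⧸ AddSubgroup.closure (tensorRelations N M))

/-- The elementary tensor `n ⊗ m`. -/
def tmul {N : RightMod R} {M : LeftMod R} (r : R) (n : N.obj.obj (op r)) (m : M.obj.obj r) :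
    tensorObj N M :=
  QuotientAddGroup.mk' (AddSubgroup.closure (tensorRelations N M))
    (DirectSum.of (fun r : R ↦ (N.obj.obj (op r) ⊗[ℤ] M.obj.obj r)) r (n ⊗ₜ[ℤ] m))

lemma tmul_balanced {N : RightMod R} {M : LeftMod R} {r s : R} (f : r ⟶ s)
    (n : N.obj.obj (op s)) (m : M.obj.obj r) :
    tmul r (N.obj.map f.op n) m = tmul s n (M.obj.map f m) :=
  (QuotientAddGroup.eq_iff_sub_mem).2 (AddSubgroup.subset_closure ⟨r, s, f, n, m, rfl⟩)

lemma tensorObj_hom_ext {N : RightMod R} {M : LeftMod R} {A : AddCommGrpCat.{u}}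
    {φ ψ : tensorObj N M ⟶ A}
    (h : ∀ (r : R) (n : N.obj.obj (op r)) (m : M.obj.obj r), φ (tmul r n m) = ψ (tmul r n m)) :
    φ = ψ := by
  apply AddCommGrpCat.hom_ext
  refine QuotientAddGroup.addMonoidHom_ext _ (DirectSum.addHom_ext fun r z ↦ ?_)
  induction z using TensorProduct.induction_on with
  | zero => simp
  | tmul n m => exact h r n m
  | add x y hx hy => rw [map_add, map_add, map_add, hx, hy]

/-- The map `N ⊗_R M ⟶ A` induced by a balanced family of biadditive maps. -/
def tensorDesc {N : RightMod R} {M : LeftMod R} {A : AddCommGrpCat.{u}}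
    (φ : ∀ r : R, N.obj.obj (op r) →+ M.obj.obj r →+ A)
    (hφ : ∀ {r s : R} (f : r ⟶ s) (n : N.obj.obj (op s)) (m : M.obj.obj r),
      φ r (N.obj.map f.op n) m = φ s n (M.obj.map f m)) :
    tensorObj N M ⟶ A :=
  AddCommGrpCat.ofHom <| QuotientAddGroup.lift _
    (DirectSum.toAddMonoid fun r ↦ TensorProduct.liftAddHom (φ r) (fun k n m ↦ by simp)) <| by
      rw [AddSubgroup.closure_le]
      rintro _ ⟨r, s, f, n, m, rfl⟩
      simp [hφ]

@[simp]
lemma tensorDesc_tmul {N : RightMod R} {M : LeftMod R} {A : AddCommGrpCat.{u}}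
    (φ : ∀ r : R, N.obj.obj (op r) →+ M.obj.obj r →+ A)
    (hφ : ∀ {r s : R} (f : r ⟶ s) (n : N.obj.obj (op s)) (m : M.obj.obj r),
      φ r (N.obj.map f.op n) m = φ s n (M.obj.map f m))
    (r : R) (n : N.obj.obj (op r)) (m : M.obj.obj r) :
    tensorDesc φ hφ (tmul r n m) = φ r n m := by
  exact DirectSum.toAddMonoid_of (γ := A) (fun r ↦ TensorProduct.liftAddHom (R := ℤ) (φ r)
    (fun k n m ↦ by simp)) r (n ⊗ₜ[ℤ] m)

lemma tmul_add {N : RightMod R} {M : LeftMod R} (r : R) (n : N.obj.obj (op r))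
    (m m' : M.obj.obj r) : tmul r n (m + m') = tmul r n m + tmul r n m' := by
  simp only [tmul, TensorProduct.tmul_add, map_add]
  rfl

lemma add_tmul {N : RightMod R} {M : LeftMod R} (r : R) (n n' : N.obj.obj (op r))
    (m : M.obj.obj r) : tmul r (n + n') m = tmul r n m + tmul r n' m := by
  simp only [tmul, TensorProduct.add_tmul, map_add]
  rfl

/-- The biadditive map `(n, m) ↦ a n ⊗ b m`. -/
def tensorMapAux {N N' : RightMod R} {M M' : LeftMod R} (a : N ⟶ N') (b : M ⟶ M') (r : R) :
    N.obj.obj (op r) →+ M.obj.obj r →+ tensorObj N' M' :=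
  AddMonoidHom.mk'
    (fun n ↦ AddMonoidHom.mk' (fun m ↦ tmul r (a.hom.app (op r) n) (b.hom.app r m))
      (fun m m' ↦ by rw [map_add, tmul_add]))
    (fun n n' ↦ by
      ext m
      change tmul r (a.hom.app (op r) (n + n')) (b.hom.app r m) = _
      rw [map_add, add_tmul]
      rfl)

lemma tensorMapAux_balanced {N N' : RightMod R} {M M' : LeftMod R} (a : N ⟶ N') (b : M ⟶ M')
    {r s : R} (f : r ⟶ s) (n : N.obj.obj (op s)) (m : M.obj.obj r) :
    tensorMapAux a b r (N.obj.map f.op n) m = tensorMapAux a b s n (M.obj.map f m) := by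
  change tmul r (a.hom.app (op r) (N.obj.map f.op n)) (b.hom.app r m) =
    tmul s (a.hom.app (op s) n) (b.hom.app s (M.obj.map f m))
  rw [NatTrans.naturality_apply a.hom, NatTrans.naturality_apply b.hom, tmul_balanced]

/-- The map `a ⊗ b : N ⊗_R M ⟶ N' ⊗_R M'`. -/
def tensorMap {N N' : RightMod R} {M M' : LeftMod R} (a : N ⟶ N') (b : M ⟶ M') :
    tensorObj N M ⟶ tensorObj N' M' :=
  tensorDesc (fun r ↦ tensorMapAux a b r)
    (fun f n m ↦ tensorMapAux_balanced a b f n m)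

@[simp]
lemma tensorMap_tmul {N N' : RightMod R} {M M' : LeftMod R} (a : N ⟶ N') (b : M ⟶ M')
    (r : R) (n : N.obj.obj (op r)) (m : M.obj.obj r) :
    tensorMap a b (tmul r n m) = tmul r (a.hom.app (op r) n) (b.hom.app r m) :=
  tensorDesc_tmul (fun r ↦ tensorMapAux a b r) (fun f n m ↦ tensorMapAux_balanced a b f n m) r n m

variable (R) in
/-- The bifunctor `(N, M) ↦ N ⊗_R M`. -/
def tensor : RightMod R ⥤ LeftMod R ⥤ AddCommGrpCat.{u} where
  obj N :=
    { obj M := tensorObj N M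
      map b := tensorMap (𝟙 N) b
      map_id M := tensorObj_hom_ext fun r n m ↦ by simp
      map_comp b b' := tensorObj_hom_ext fun r n m ↦ by simp }
  map a :=
    { app M := tensorMap a (𝟙 M)
      naturality M M' b := tensorObj_hom_ext fun r n m ↦ by simp }
  map_id N := by
    ext1
    ext1 M
    exact tensorObj_hom_ext fun r n m ↦ by simp
  map_comp a a' := by
    ext1
    ext1 M
    exact tensorObj_hom_ext fun r n m ↦ by simp

end Tensor

section Dual

variable {R S : Type u} [SmallCategory R] [Preadditive R] [SmallCategory S] [Preadditive S]

instance (s : S) : Functor.IsAccessible.{u} (evalAt s) :=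
  ⟨⟨_, Cardinal.fact_isRegular_aleph0, inferInstance⟩⟩

/-- The abelian group of natural transformations `Φ ⟶ N ⊗_R -`,
shrunk to the base universe. -/
def dualGrp (Φ : LeftMod R ⥤ AddCommGrpCat.{u}) [Functor.IsAccessible.{u} Φ] (N : RightMod R) :
    AddCommGrpCat.{u} :=
  AddCommGrpCat.of (Shrink.{u} (Φ ⟶ (tensor R).obj N))

/-- The elements of `dualGrp Φ N` are the natural transformations `Φ ⟶ N ⊗_R -`. -/
def dualGrpEquiv (Φ : LeftMod R ⥤ AddCommGrpCat.{u}) [Functor.IsAccessible.{u} Φ]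
    (N : RightMod R) : dualGrp Φ N ≃+ (Φ ⟶ (tensor R).obj N) :=
  Shrink.addEquiv

/-- The map `α ↦ (a ⊗ -) ∘ α ∘ θ`. -/
def dualGrpMap {Φ Ψ : LeftMod R ⥤ AddCommGrpCat.{u}} [Functor.IsAccessible.{u} Φ]
    [Functor.IsAccessible.{u} Ψ] {N N' : RightMod R} (θ : Ψ ⟶ Φ) (a : N ⟶ N') :
    dualGrp Φ N ⟶ dualGrp Ψ N' :=
  AddCommGrpCat.ofHom (X := dualGrp Φ N) (Y := dualGrp Ψ N') <| AddMonoidHom.mk'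
    (fun α ↦ (dualGrpEquiv Ψ N').symm (θ ≫ dualGrpEquiv Φ N α ≫ (tensor R).map a))
    (fun α β ↦ by
      rw [map_add, Preadditive.add_comp, Preadditive.comp_add, map_add])

@[simp]
lemma dualGrpEquiv_map {Φ Ψ : LeftMod R ⥤ AddCommGrpCat.{u}} [Functor.IsAccessible.{u} Φ]
    [Functor.IsAccessible.{u} Ψ] {N N' : RightMod R} (θ : Ψ ⟶ Φ) (a : N ⟶ N')
    (α : dualGrp Φ N) :
    dualGrpEquiv Ψ N' (dualGrpMap θ a α) = θ ≫ dualGrpEquiv Φ N α ≫ (tensor R).map a :=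
  (dualGrpEquiv Ψ N').apply_symm_apply _

/-- The natural transformation `M(s) ⟶ M(t)` induced by `f : s ⟶ t`. -/
def evalAtMap {s t : S} (f : s ⟶ t) : evalAt s ⟶ evalAt t :=
  Functor.whiskerLeft (AdditiveFunctor.forget S AddCommGrpCat.{u}) ((evaluation _ _).map f)

/-- The Auslander-Gruson-Jensen dual `DF : Mod-R ⥤ Mod-S` of an accessible functor
`F : R-Mod ⥤ S-Mod`, given by `((DF)N)(s) = Hom(F(-)(s), N ⊗_R -)`. -/
def dual (F : LeftMod R ⥤ LeftMod S) [Functor.IsAccessible.{u} F] : RightMod R ⥤ RightMod S where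
  obj N :=
    { obj :=
        { obj s := dualGrp (F ⋙ evalAt s.unop) N
          map f := dualGrpMap (Functor.whiskerLeft F (evalAtMap f.unop)) (𝟙 N)
          map_id s := by
            ext α
            apply (dualGrpEquiv _ _).injective
            rw [dualGrpEquiv_map]
            ext M x
            simp [evalAtMap]
          map_comp f g := by
            ext α
            apply (dualGrpEquiv _ _).injective
            simp only [dualGrpEquiv_map, AddCommGrpCat.hom_comp, AddMonoidHom.comp_apply]
            ext M x
            simp [evalAtMap] }
      property := ⟨fun {s t f g} ↦ by
        ext α
        apply (dualGrpEquiv _ _).injective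
        simp only [dualGrpEquiv_map, AddCommGrpCat.hom_add, AddMonoidHom.add_apply, map_add]
        ext M x
        simp [evalAtMap, Functor.map_add]⟩ }
  map a := ObjectProperty.homMk
    { app s := dualGrpMap (𝟙 _) a
      naturality s t f := by
        ext α
        apply (dualGrpEquiv _ _).injective
        simp only [dualGrpEquiv_map, AddCommGrpCat.hom_comp, AddMonoidHom.comp_apply]
        ext M x
        simp }
  map_id N := by
    ext s α
    apply (dualGrpEquiv _ _).injective
    refine (dualGrpEquiv_map _ _ _).trans ?_
    simp
  map_comp a b := by
    ext s α
    apply (dualGrpEquiv _ _).injective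
    refine (dualGrpEquiv_map _ _ _).trans ?_
    ext M x
    simp

end Dual
end AGJ
end

noncomputable section
namespace AGJ

/-! ### Products of modules and weakly initial squares. -/

section Limits
variable (R : Type u) [SmallCategory R] [Preadditive R]

/-! The point is that `(DF)N ⊗_S -` is the right Kan extension of `N ⊗_R -` along `F`, with counit
`ev`: an element of `(DF)N ⊗_S A` is the same thing as a natural zero-preserving map `Hom(A, F-) ⟶ N
⊗_R -` (`exists_evHom_eq`, `eq_of_evHom_eq`). The universal property gives `Nat(Φ, (DF)N ⊗_S -) ≅
Nat(ΦF, N ⊗_R -)` for additive `Φ` (`compHom_bijective`), and `Φ = G(-)(t)` is the theorem.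

For `A` representable this description is Yoneda and the definition of `DF`. The general case is
reached through free modules. The crux is `exists_evHom_sigma`, an injectivity property of `N ⊗_R
-`: given `p : Z ⟶ P` with `Z` free, a transformation on `Hom(P, F-)` that vanishes on the kernel of
precomposition with `p` extends to one on `Hom(Z, F-)` coming from an element of `(DF)N ⊗_S Z`. As
`F` is accessible and preserves products, `Hom(Z, F-)` has a generator, and there is a weakly
initial square relating it to `Hom(P, F-)`. Right exactness of `N ⊗_R -` then yields the value of
the extension on the generator, and compatibility of the tensor product with coproducts makes that
value a finite sum of components. Covering `A` by a free module gives existence; covering the kernel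
of that cover as well gives uniqueness. -/

instance additiveFunctor_isClosedUnderLimitsOfShape (J : Type u) [SmallCategory J] :
    (additiveFunctor R AddCommGrpCat.{u}).IsClosedUnderLimitsOfShape J where
  limitsOfShape_le := by
    rintro X ⟨h⟩
    refine ⟨fun {r s f g} ↦ ?_⟩
    refine (isLimitOfPreserves ((evaluation _ _).obj s) h.isLimit).hom_ext fun j ↦ ?_
    have : (h.diag.obj j).Additive := h.prop_diag_obj j
    have hn := fun f : r ⟶ s ↦ (h.π.app j).naturality f
    dsimp at hn ⊢
    rw [Preadditive.add_comp, hn, hn, hn, Functor.map_add, Preadditive.comp_add]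

instance : HasLimitsOfSize.{u, u} (LeftMod R) where
  has_limits_of_shape _ _ := inferInstance

lemma fact_isRegular_max (κ κ' : Cardinal.{u}) [h : Fact κ.IsRegular] [h' : Fact κ'.IsRegular] :
    Fact (max κ κ').IsRegular := by
  rcases max_choice κ κ' with e | e <;> rw [e]
  exacts [h, h']

variable {R}
variable {S : Type u} [SmallCategory S] [Preadditive S]

lemma isPresentable_leftMod (M : LeftMod R) : IsPresentable.{u} M :=
  have := Cardinal.fact_isRegular_aleph0.{u}
  have : IsAccessibleCategory.{u} (LeftMod R) := ⟨⟨Cardinal.aleph0.{u}, this, inferInstance⟩⟩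
  inferInstance

/-- Every commutative square `p ≫ h = y ≫ F φ` is a quotient of one of them. -/
lemma exists_weakly_initial_square (F : LeftMod R ⥤ LeftMod S) [Functor.IsAccessible.{u} F]
    [∀ ι : Type u, PreservesLimitsOfShape (Discrete ι) F] {Z P : LeftMod S} {A : LeftMod R}
    (p : Z ⟶ P) (y : Z ⟶ F.obj A) :
    ∃ (B : LeftMod R) (φ₀ : A ⟶ B) (h₀ : P ⟶ F.obj B), p ≫ h₀ = y ≫ F.map φ₀ ∧
      ∀ (M : LeftMod R) (φ : A ⟶ M) (h : P ⟶ F.obj M), p ≫ h = y ≫ F.map φ →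
        ∃ ψ : B ⟶ M, φ₀ ≫ ψ = φ ∧ h₀ ≫ F.map ψ = h := by
  -- A single regular `κ` for which `F` is accessible and `Z`, `P`, `A` are presentable.
  obtain ⟨κ₁, _, _⟩ := Functor.IsAccessible.exists_cardinal (F := F)
  obtain ⟨κ₂, _, h₂⟩ := (isPresentable_leftMod Z).exists_cardinal
  obtain ⟨κ₃, _, h₃⟩ := (isPresentable_leftMod P).exists_cardinal
  obtain ⟨κ₄, _, h₄⟩ := (isPresentable_leftMod A).exists_cardinal
  have := fact_isRegular_max κ₁ κ₂
  have := fact_isRegular_max κ₃ κ₄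
  have := fact_isRegular_max (max κ₁ κ₂) (max κ₃ κ₄)
  generalize hκ : max (max κ₁ κ₂) (max κ₃ κ₄) = κ at this
  have : F.IsCardinalAccessible κ := F.isCardinalAccessible_of_le (κ := κ₁) (by simp [← hκ])
  have : IsCardinalPresentable Z κ :=
    have : IsCardinalPresentable Z κ₂ := h₂
    isCardinalPresentable_of_le Z (κ := κ₂) (by simp [← hκ])
  have : IsCardinalPresentable P κ :=
    have : IsCardinalPresentable P κ₃ := h₃
    isCardinalPresentable_of_le P (κ := κ₃) (by simp [← hκ])
  have : IsCardinalPresentable A κ :=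
    have : IsCardinalPresentable A κ₄ := h₄
    isCardinalPresentable_of_le A (κ := κ₄) (by simp [← hκ])
  obtain ⟨Q, _, hQ⟩ := HasCardinalFilteredGenerator.exists_small_generator (LeftMod R) κ
  let I : Type _ := Σ M : Subtype Q,
    {x : (A ⟶ M.1) × (P ⟶ F.obj M.1) // p ≫ x.2 = y ≫ F.map x.1}
  have : Small.{u} (Subtype Q) := inferInstanceAs (Small.{u} (Subtype Q))
  let f : Shrink.{u} I → LeftMod R := fun i ↦ ((equivShrink I).symm i).1.1
  let hF := isLimitOfHasProductOfPreservesLimit F f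
  -- The product of all squares with target in the small generating set `Q`; `F` preserves it, so
  -- the maps `P ⟶ F M` assemble too.
  refine ⟨∏ᶜ f, Pi.lift fun i ↦ ((equivShrink I).symm i).2.1.1,
    Fan.IsLimit.lift hF fun i ↦ ((equivShrink I).symm i).2.1.2, ?_, ?_⟩
  · refine Fan.IsLimit.hom_ext hF _ _ fun i ↦ ?_
    rw [Category.assoc, Fan.IsLimit.fac, Category.assoc]
    refine (((equivShrink I).symm i).2.2).trans ?_
    congr 1
    change _ = F.map _ ≫ F.map (Pi.π f i)
    rw [← F.map_comp, Pi.lift_π]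
  · intro M φ h e
    obtain ⟨J, _, _, ⟨c⟩⟩ := hQ.exists_colimitsOfShape M
    have := F.preservesColimitsOfShape_of_isCardinalAccessible κ J
    have hc := isColimitOfPreserves F c.isColimit
    obtain ⟨j₁, φ₁, hφ₁⟩ := IsCardinalPresentable.exists_hom_of_isColimit κ c.isColimit φ
    obtain ⟨j₂, h₂, hh₂⟩ := IsCardinalPresentable.exists_hom_of_isColimit κ hc h
    -- `M` is a `κ`-filtered colimit of objects of `Q`, preserved by `F`. Both maps factor through
    -- finite stages of the diagram in the sense of a single index, and the square, commuting in the
    -- colimit, already commutes at some common stage `j`.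
    obtain ⟨j, u, v, huv⟩ := IsCardinalPresentable.exists_eq_of_isColimit κ hc
      (y ≫ F.map φ₁) (p ≫ h₂) (by
        rw [Category.assoc, Category.assoc, hh₂, e, ← hφ₁, F.map_comp]
        rfl)
    let i : I := ⟨⟨_, c.prop_diag_obj j⟩, ⟨φ₁ ≫ c.diag.map u, h₂ ≫ F.map (c.diag.map v)⟩, by
      simpa using huv.symm⟩
    -- Generalizing over `i'` avoids dependent rewriting along the round trip through `Shrink`.
    have key : ∀ i' : I, i = i' → ∃ ψ : i'.1.1 ⟶ M, i'.2.1.1 ≫ ψ = φ ∧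
        i'.2.1.2 ≫ F.map ψ = h := by
      rintro _ rfl
      refine ⟨c.ι.app j, ?_, ?_⟩
      · simp [i, ← hφ₁]
      · rw [← hh₂]
        change (h₂ ≫ F.map (c.diag.map v)) ≫ F.map (c.ι.app j) = h₂ ≫ F.map (c.ι.app j₂)
        rw [Category.assoc, ← F.map_comp]
        simp
    obtain ⟨ψ, hψ₁, hψ₂⟩ := key _ ((equivShrink I).symm_apply_apply i).symm
    refine ⟨Pi.π f (equivShrink I i) ≫ ψ, ?_, ?_⟩
    · rw [Pi.lift_π_assoc]
      exact hψ₁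
    · rw [F.map_comp, ← Category.assoc]
      refine Eq.trans ?_ hψ₂
      congr 1
      exact Fan.IsLimit.fac hF _ _

end Limits

/-! ### Right exactness of the tensor product and its behaviour on coproducts. -/

section TensorColimits
variable {R : Type u} [SmallCategory R] [Preadditive R]

lemma tensorObj_induction {N : RightMod R} {M : LeftMod R} {p : tensorObj N M → Prop}
    (zero : p 0) (tmul : ∀ (r : R) (n : N.obj.obj (op r)) (m : M.obj.obj r), p (tmul r n m))
    (add : ∀ z w, p z → p w → p (z + w)) (z : tensorObj N M) : p z := by
  classical
  obtain ⟨z, rfl⟩ := QuotientAddGroup.mk'_surjective _ z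
  induction z using DirectSum.induction_on with
  | zero =>
    rw [map_zero]
    exact zero
  | of r z =>
    induction z using TensorProduct.induction_on with
    | zero =>
      rw [map_zero, map_zero]
      exact zero
    | tmul n m => exact tmul r n m
    | add x y hx hy =>
      rw [map_add, map_add]
      exact add _ _ hx hy
  | add x y hx hy =>
    rw [map_add]
    exact add _ _ hx hy

lemma zero_tmul {N : RightMod R} {M : LeftMod R} (r : R) (m : M.obj.obj r) :
    tmul r (0 : N.obj.obj (op r)) m = 0 := by
  simpa using add_tmul (N := N) r 0 0 m

@[simp]
lemma tensor_obj_map_tmul (N : RightMod R) {M M' : LeftMod R} (b : M ⟶ M') (r : R)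
    (n : N.obj.obj (op r)) (m : M.obj.obj r) :
    ((tensor R).obj N).map b (tmul r n m) = tmul r n (b.hom.app r m) := by
  exact tensorMap_tmul (𝟙 N) b r n m

@[simp]
lemma tensor_map_app_tmul {N N' : RightMod R} (a : N ⟶ N') (M : LeftMod R) (r : R)
    (n : N.obj.obj (op r)) (m : M.obj.obj r) :
    ((tensor R).map a).app M (tmul r n m) = tmul r (a.hom.app (op r) n) m := by
  exact tensorMap_tmul a (𝟙 M) r n m

instance (N : RightMod R) : ((tensor R).obj N).Additive where
  map_add {M M' f g} := tensorObj_hom_ext fun r n m ↦ by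
    refine (tensor_obj_map_tmul N (f + g) r n m).trans ((tmul_add r n _ _).trans ?_)
    exact congrArg₂ (· + ·) (tensor_obj_map_tmul N f r n m).symm
      (tensor_obj_map_tmul N g r n m).symm

/-- The functor `E ↦ Hom(N(-), E)`. -/
def homFrom (N : RightMod R) : AddCommGrpCat.{u} ⥤ LeftMod R where
  obj E := AdditiveFunctor.of (N.obj.rightOp ⋙ preadditiveYoneda.obj E)
  map f := ObjectProperty.homMk (Functor.whiskerLeft N.obj.rightOp (preadditiveYoneda.map f))

/-- The biadditive map `(n, m) ↦ g(m)(n)`. -/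
def uncurryAux {N : RightMod R} {M : LeftMod R} {E : AddCommGrpCat.{u}}
    (g : M ⟶ (homFrom N).obj E) (r : R) : N.obj.obj (op r) →+ M.obj.obj r →+ E :=
  AddMonoidHom.flip (AddMonoidHom.mk'
    (fun m ↦ AddCommGrpCat.Hom.hom (show N.obj.obj (op r) ⟶ E from g.hom.app r m))
    (fun m m' ↦ by
      rw [map_add]
      rfl))

lemma uncurryAux_balanced {N : RightMod R} {M : LeftMod R} {E : AddCommGrpCat.{u}}
    (g : M ⟶ (homFrom N).obj E) {r s : R} (f : r ⟶ s) (n : N.obj.obj (op s))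
    (m : M.obj.obj r) :
    uncurryAux g r (N.obj.map f.op n) m = uncurryAux g s n (M.obj.map f m) := by
  have h : (show N.obj.obj (op s) ⟶ E from g.hom.app s (M.obj.map f m)) =
      N.obj.map f.op ≫ (show N.obj.obj (op r) ⟶ E from g.hom.app r m) :=
    ConcreteCategory.congr_hom (g.hom.naturality f) m
  exact (ConcreteCategory.congr_hom h n).symm

/-- Currying `Hom(N ⊗_R M, E) ≃ Hom(M, Hom(N(-), E))`. -/
def tensorHomEquiv (N : RightMod R) (M : LeftMod R) (E : AddCommGrpCat.{u}) :
    (tensorObj N M ⟶ E) ≃ (M ⟶ (homFrom N).obj E) where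
  toFun φ := ObjectProperty.homMk
    { app r := AddCommGrpCat.ofHom (Y := AddCommGrpCat.of (N.obj.obj (op r) ⟶ E)) <|
        AddMonoidHom.mk' (fun m ↦ AddCommGrpCat.ofHom <| AddMonoidHom.mk'
            (fun n ↦ φ (tmul r n m)) (fun n n' ↦ by rw [add_tmul, map_add]))
          (fun m m' ↦ by
            ext n
            change φ (tmul r n (m + m')) = φ (tmul r n m) + φ (tmul r n m')
            rw [tmul_add, map_add])
      naturality r s f := by
        ext m
        apply AddCommGrpCat.hom_ext
        ext n
        change φ (tmul s n (M.obj.map f m)) = φ (tmul r (N.obj.map f.op n) m)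
        rw [tmul_balanced] }
  invFun g := tensorDesc (fun r ↦ uncurryAux g r) (fun f n m ↦ uncurryAux_balanced g f n m)
  left_inv φ := tensorObj_hom_ext fun r n m ↦
    tensorDesc_tmul (fun r ↦ uncurryAux _ r) (fun f n m ↦ uncurryAux_balanced _ f n m) r n m
  right_inv g := by
    ext r m
    apply AddCommGrpCat.hom_ext
    ext n
    exact tensorDesc_tmul (fun r ↦ uncurryAux g r) (fun f n m ↦ uncurryAux_balanced g f n m) r n m

/-- `N ⊗_R -` is left adjoint to `Hom(N(-), -)`. -/
def tensorAdj (N : RightMod R) : (tensor R).obj N ⊣ homFrom N :=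
  Adjunction.mkOfHomEquiv
    { homEquiv := tensorHomEquiv N
      homEquiv_naturality_left_symm {M M' E} f g := tensorObj_hom_ext fun r n m ↦ by
        refine (tensorDesc_tmul (fun r ↦ uncurryAux _ r)
          (fun f n m ↦ uncurryAux_balanced _ f n m) r n m).trans ?_
        refine Eq.trans ?_ (congrArg ((tensorHomEquiv N M' E).symm g)
          (tensor_obj_map_tmul N f r n m).symm)
        exact (tensorDesc_tmul (fun r ↦ uncurryAux g r)
          (fun f n m ↦ uncurryAux_balanced g f n m) r n _).symm
      homEquiv_naturality_right f g := rfl }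

instance (N : RightMod R) : PreservesColimitsOfSize.{u, u} ((tensor R).obj N) :=
  (tensorAdj N).leftAdjoint_preservesColimits

/-- Right exactness: being a left adjoint, `N ⊗_R -` preserves the cokernel of `f`. -/
lemma exists_tensor_map_eq (N : RightMod R) {M M' : LeftMod R} (f : M ⟶ M')
    (z : ((tensor R).obj N).obj M') (hz : ((tensor R).obj N).map (cokernel.π f) z = 0) :
    ∃ w, ((tensor R).obj N).map f w = z := by
  let F := (tensor R).obj N
  let C := ShortComplex.mk (F.map f) (F.map (cokernel.π f)) (by
    rw [← F.map_comp, cokernel.condition, F.map_zero])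
  have hC : C.Exact := C.exact_of_g_is_cokernel
    (isColimitOfHasCokernelOfPreservesColimit F f)
  exact C.ab_exact_iff.1 hC z hz

lemma map_map_apply {C : Type*} [Category* C] (Φ : C ⥤ AddCommGrpCat.{u}) {A B D : C}
    (f : A ⟶ B) (g : B ⟶ D) (x : Φ.obj A) : Φ.map g (Φ.map f x) = Φ.map (f ≫ g) x := by
  rw [Φ.map_comp, ConcreteCategory.comp_apply]

/-- A functor preserving coproducts sends every element of a coproduct to a finite sum of its
components. -/
lemma exists_sum_map_sigma (Φ : LeftMod R ⥤ AddCommGrpCat.{u}) [Φ.Additive]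
    [PreservesColimitsOfSize.{u, u} Φ] {J : Type u} [DecidableEq J] (A : J → LeftMod R)
    (z : Φ.obj (∐ A)) :
    ∃ s : Finset J, ∑ j ∈ s, Φ.map (Sigma.ι A j) (Φ.map (Sigma.π A j) z) = z := by
  -- Asking for all larger finite sets makes the condition stable under addition, so that it cuts
  -- out a subgroup `H`.
  suffices ∃ s : Finset J, ∀ s', s ⊆ s' →
      ∑ j ∈ s', Φ.map (Sigma.ι A j) (Φ.map (Sigma.π A j) z) = z from
    this.imp fun s h ↦ h s subset_rfl
  let H : AddSubgroup (Φ.obj (∐ A)) :=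
    { carrier := {z | ∃ s : Finset J, ∀ s', s ⊆ s' →
        ∑ j ∈ s', Φ.map (Sigma.ι A j) (Φ.map (Sigma.π A j) z) = z}
      zero_mem' := ⟨∅, fun s' _ ↦ by simp⟩
      add_mem' := by
        rintro z w ⟨s, hs⟩ ⟨t, ht⟩
        refine ⟨s ∪ t, fun s' h ↦ ?_⟩
        simp only [map_add, Finset.sum_add_distrib]
        rw [hs s' (Finset.union_subset_left h), ht s' (Finset.union_subset_right h)]
      neg_mem' := by
        rintro z ⟨s, hs⟩
        refine ⟨s, fun s' h ↦ ?_⟩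
        simp only [map_neg, Finset.sum_neg_distrib]
        rw [hs s' h] }
  -- `Φ.obj (∐ A)` is the coproduct of the `Φ.obj (A j)`, so it suffices that `H` contains the image
  -- of each of them.
  have key : AddCommGrpCat.ofHom (QuotientAddGroup.mk' H) = 0 := by
    refine Cofan.IsColimit.hom_ext (isColimitOfHasCoproductOfPreservesColimit Φ A) _ _ fun j ↦ ?_
    ext x
    refine (QuotientAddGroup.eq_zero_iff _).2 ⟨{j}, fun s' h ↦ ?_⟩
    change ∑ k ∈ s', Φ.map (Sigma.ι A k) (Φ.map (Sigma.π A k) (Φ.map (Sigma.ι A j) x)) =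
      Φ.map (Sigma.ι A j) x
    rw [Finset.sum_eq_single_of_mem j (h (by simp))]
    · rw [map_map_apply Φ _ (Sigma.π A j), Sigma.ι_π_eq_id]
      simp
    · intro k _ hk
      rw [map_map_apply Φ _ (Sigma.π A k), Sigma.ι_π_of_ne _ hk.symm]
      simp
  exact (QuotientAddGroup.eq_zero_iff z).1 (ConcreteCategory.congr_hom key z)

end TensorColimits

/-! ### The evaluation map `(DF)N ⊗_S FM ⟶ N ⊗_R M`. -/

section Evaluation
variable {R S : Type u} [SmallCategory R] [Preadditive R] [SmallCategory S] [Preadditive S]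

lemma reprEquiv_comp (s : S) {M M' : LeftMod S} (f : repr s ⟶ M) (g : M ⟶ M') :
    reprEquiv s M' (f ≫ g) = g.hom.app s (reprEquiv s M f) := rfl


/-- The elements of `((DF)N)(s)` are the natural transformations `F(-)(s) ⟶ N ⊗_R -`. -/
def toNat {F : LeftMod R ⥤ LeftMod S} [Functor.IsAccessible.{u} F] {N : RightMod R} {s : S} :
    ((dual F).obj N).obj.obj (op s) ≃+ (F ⋙ evalAt s ⟶ (tensor R).obj N) :=
  dualGrpEquiv (F ⋙ evalAt s) N

lemma toNat_obj_map {F : LeftMod R ⥤ LeftMod S} [Functor.IsAccessible.{u} F] {N : RightMod R}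
    {s t : S} (f : s ⟶ t) (τ : ((dual F).obj N).obj.obj (op t)) :
    toNat (((dual F).obj N).obj.map f.op τ) = Functor.whiskerLeft F (evalAtMap f) ≫ toNat τ := by
  have h : toNat (((dual F).obj N).obj.map f.op τ) =
      Functor.whiskerLeft F (evalAtMap f) ≫ toNat τ ≫ (tensor R).map (𝟙 N) :=
    dualGrpEquiv_map _ _ _
  rwa [CategoryTheory.Functor.map_id, Category.comp_id] at h

lemma toNat_map_app {F : LeftMod R ⥤ LeftMod S} [Functor.IsAccessible.{u} F] {N N' : RightMod R}
    (a : N ⟶ N') {s : S} (τ : ((dual F).obj N).obj.obj (op s)) :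
    toNat (((dual F).map a).hom.app (op s) τ) = toNat τ ≫ (tensor R).map a :=
  (dualGrpEquiv_map _ _ _).trans (Category.id_comp _)

variable (F : LeftMod R ⥤ LeftMod S) [Functor.IsAccessible.{u} F]

/-- The biadditive map `(τ, x) ↦ τ x`. -/
def evAux (N : RightMod R) (M : LeftMod R) (s : S) :
    ((dual F).obj N).obj.obj (op s) →+ (F.obj M).obj.obj s →+ ((tensor R).obj N).obj M :=
  AddMonoidHom.mk' (fun τ ↦ AddCommGrpCat.Hom.hom ((toNat τ).app M)) (fun τ τ' ↦ by
    rw [map_add]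
    rfl)

lemma evAux_balanced (N : RightMod R) (M : LeftMod R) {s t : S} (f : s ⟶ t)
    (τ : ((dual F).obj N).obj.obj (op t)) (x : (F.obj M).obj.obj s) :
    evAux F N M s (((dual F).obj N).obj.map f.op τ) x = evAux F N M t τ ((F.obj M).obj.map f x) := by
  exact ConcreteCategory.congr_hom (NatTrans.congr_app (toNat_obj_map f τ) M) x

/-- The map `(DF)N ⊗_S FM ⟶ N ⊗_R M` sending `τ ⊗ x` to `τ x`. -/
def ev (N : RightMod R) : F ⋙ (tensor S).obj ((dual F).obj N) ⟶ (tensor R).obj N where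
  app M := tensorDesc (fun s ↦ evAux F N M s) (fun f τ x ↦ evAux_balanced F N M f τ x)
  naturality M M' φ := tensorObj_hom_ext fun s τ x ↦ by
    change tensorDesc (fun s ↦ evAux F N M' s) (fun f τ x ↦ evAux_balanced F N M' f τ x)
      (((tensor S).obj ((dual F).obj N)).map (F.map φ) (tmul s τ x)) =
      ((tensor R).obj N).map φ (tensorDesc (fun s ↦ evAux F N M s)
        (fun f τ x ↦ evAux_balanced F N M f τ x) (tmul s τ x))
    rw [tensor_obj_map_tmul, tensorDesc_tmul, tensorDesc_tmul]
    exact ConcreteCategory.congr_hom ((toNat τ).naturality φ) x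

lemma ev_app_tmul (N : RightMod R) (M : LeftMod R) (s : S) (τ : ((dual F).obj N).obj.obj (op s))
    (x : (F.obj M).obj.obj s) : (ev F N).app M (tmul s τ x) = (toNat τ).app M x :=
  tensorDesc_tmul (fun s ↦ evAux F N M s) (fun f τ x ↦ evAux_balanced F N M f τ x) s τ x

/-- The map `(DF)N ⊗_S A ⟶ N ⊗_R M` sending `τ ⊗ a` to `τ (h a)`. -/
def evHom (N : RightMod R) {A : LeftMod S} {M : LeftMod R} (h : A ⟶ F.obj M) :
    ((tensor S).obj ((dual F).obj N)).obj A ⟶ ((tensor R).obj N).obj M :=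
  ((tensor S).obj ((dual F).obj N)).map h ≫ (ev F N).app M

lemma evHom_tmul (N : RightMod R) {A : LeftMod S} {M : LeftMod R} (h : A ⟶ F.obj M) (s : S)
    (τ : ((dual F).obj N).obj.obj (op s)) (a : A.obj.obj s) :
    evHom F N h (tmul s τ a) = (toNat τ).app M (h.hom.app s a) := by
  refine Eq.trans ?_ (ev_app_tmul F N M s τ _)
  exact congrArg ((ev F N).app M) (tensor_obj_map_tmul _ h s τ a)

lemma evHom_comp (N : RightMod R) {A A' : LeftMod S} {M : LeftMod R} (f : A' ⟶ A)
    (h : A ⟶ F.obj M) :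
    evHom F N (f ≫ h) = ((tensor S).obj ((dual F).obj N)).map f ≫ evHom F N h := by
  simp [evHom]

lemma evHom_comp_apply (N : RightMod R) {A A' : LeftMod S} {M : LeftMod R} (f : A' ⟶ A)
    (h : A ⟶ F.obj M) (w : ((tensor S).obj ((dual F).obj N)).obj A') :
    evHom F N (f ≫ h) w = evHom F N h (((tensor S).obj ((dual F).obj N)).map f w) := by
  rw [evHom_comp, ConcreteCategory.comp_apply]

lemma evHom_map (N : RightMod R) {A : LeftMod S} {M M' : LeftMod R} (h : A ⟶ F.obj M)
    (ψ : M ⟶ M') : evHom F N (h ≫ F.map ψ) = evHom F N h ≫ ((tensor R).obj N).map ψ := by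
  have := (ev F N).naturality ψ
  dsimp at this
  simp [evHom, this]

end Evaluation

/-! ### Uniqueness over free modules. -/

section Comparison
variable {R S : Type u} [SmallCategory R] [Preadditive R] [SmallCategory S] [Preadditive S]
variable (F : LeftMod R ⥤ LeftMod S) [Functor.IsAccessible.{u} F]
  (N : RightMod R)

/-- Every element of `(DF)N ⊗_S Hom(s, -)` has the form `τ ⊗ 𝟙`, and the maps `Hom(s, -) ⟶ FM` are
the elements of `(FM)(s)`, so the hypothesis says that `τ` vanishes everywhere. -/
lemma eq_zero_of_evHom_repr (s : S)
    (v : ((tensor S).obj ((dual F).obj N)).obj (repr s))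
    (hv : ∀ (M : LeftMod R) (h : repr s ⟶ F.obj M), evHom F N h v = 0) : v = 0 := by
  obtain ⟨τ, rfl⟩ : ∃ τ : ((dual F).obj N).obj.obj (op s),
      v = tmul (M := repr s) s τ (𝟙 s : s ⟶ s) := by
    clear hv
    induction v using tensorObj_induction with
    | zero => exact ⟨0, (zero_tmul _ _).symm⟩
    | tmul r n m =>
      refine ⟨((dual F).obj N).obj.map (Quiver.Hom.op (show s ⟶ r from m)) n, ?_⟩
      refine Eq.trans ?_ (tmul_balanced (M := repr s) (show s ⟶ r from m) n (𝟙 s : s ⟶ s)).symm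
      exact congrArg (tmul (M := repr s) r n) (Category.id_comp (show s ⟶ r from m)).symm
    | add z w hz hw =>
      obtain ⟨τ, rfl⟩ := hz
      obtain ⟨τ', rfl⟩ := hw
      exact ⟨τ + τ', (add_tmul _ _ _ _).symm⟩
  suffices τ = 0 by
    subst this
    exact zero_tmul _ _
  apply toNat.injective
  rw [map_zero]
  ext M x
  refine Eq.trans ?_ ((evHom_tmul F N _ s τ _).symm.trans (hv M ((reprEquiv s _).symm x)))
  exact congrArg ((toNat τ).app M) ((reprEquiv s (F.obj M)).apply_symm_apply x).symm

/-- An element over a coproduct is a finite sum of its components, and each component is tested by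
maps factoring through a projection. -/
lemma eq_zero_of_evHom_sigma {J : Type u} (t : J → S)
    (w : ((tensor S).obj ((dual F).obj N)).obj (∐ fun j ↦ repr (t j)))
    (hw : ∀ (M : LeftMod R) (h : (∐ fun j ↦ repr (t j)) ⟶ F.obj M), evHom F N h w = 0) :
    w = 0 := by
  classical
  obtain ⟨s, hs⟩ := exists_sum_map_sigma ((tensor S).obj ((dual F).obj N)) _ w
  rw [← hs]
  refine Finset.sum_eq_zero fun j _ ↦ ?_
  rw [eq_zero_of_evHom_repr F N (t j)
    (((tensor S).obj ((dual F).obj N)).map (Sigma.π (fun j ↦ repr (t j)) j) w), map_zero]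
  intro M h
  have := hw M (Sigma.π (fun j ↦ repr (t j)) j ≫ h)
  rwa [evHom_comp_apply] at this

end Comparison

/-! ### Generators and extension of natural transformations. -/

section Extension
variable {R S : Type u} [SmallCategory R] [Preadditive R] [SmallCategory S] [Preadditive S]
variable (F : LeftMod R ⥤ LeftMod S) [Functor.IsAccessible.{u} F]
  (N : RightMod R)

/-- `F(-)(s)` has a generator if `F` preserves products. -/
lemma exists_generator [∀ ι : Type u, PreservesLimitsOfShape (Discrete ι) F] (s : S) :
    ∃ (A : LeftMod R) (y : repr s ⟶ F.obj A), ∀ (M : LeftMod R) (h : repr s ⟶ F.obj M),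
      ∃ φ : A ⟶ M, y ≫ F.map φ = h := by
  -- With both corners initial, the commutativity condition is void and a weakly initial element
  -- remains.
  obtain ⟨A, _, y, -, hy⟩ := exists_weakly_initial_square F (Z := ⊥_ (LeftMod S)) (P := repr s)
    (A := ⊥_ (LeftMod R)) (initial.to _) (initial.to _)
  refine ⟨A, y, fun M h ↦ ?_⟩
  obtain ⟨φ, -, hφ⟩ := hy M (initial.to _) h (initial.hom_ext _ _)
  exact ⟨φ, hφ⟩

variable {F N}

/-- A natural transformation out of `F(-)(s)` can be prescribed on a generator. -/
lemma exists_toNat_app_generator [F.Additive] {s : S} {A : LeftMod R} (y : repr s ⟶ F.obj A)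
    (hy : ∀ (M : LeftMod R) (h : repr s ⟶ F.obj M), ∃ φ : A ⟶ M, y ≫ F.map φ = h)
    (e : ((tensor R).obj N).obj A)
    (he : ∀ (M : LeftMod R) (φ : A ⟶ M), y ≫ F.map φ = 0 → ((tensor R).obj N).map φ e = 0) :
    ∃ τ : ((dual F).obj N).obj.obj (op s), ∀ (M : LeftMod R) (φ : A ⟶ M),
      (toNat τ).app M (reprEquiv s _ (y ≫ F.map φ)) = ((tensor R).obj N).map φ e := by
  have hy' (M : LeftMod R) (x : (F.obj M).obj.obj s) :
      ∃ φ : A ⟶ M, reprEquiv s _ (y ≫ F.map φ) = x := by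
    obtain ⟨φ, hφ⟩ := hy M ((reprEquiv s _).symm x)
    exact ⟨φ, by rw [hφ, Equiv.apply_symm_apply]⟩
  choose lift hlift using hy'
  -- The value does not depend on the chosen lift: apply `he` to the difference of two lifts. This
  -- also gives additivity and naturality below.
  have key {M : LeftMod R} (φ ψ : A ⟶ M)
      (h : reprEquiv s _ (y ≫ F.map φ) = reprEquiv s _ (y ≫ F.map ψ)) :
      ((tensor R).obj N).map φ e = ((tensor R).obj N).map ψ e := by
    have h := (reprEquiv s _).injective h
    have := he M (φ - ψ) (by rw [F.map_sub, Preadditive.comp_sub, h, sub_self])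
    rw [Functor.map_sub] at this
    exact sub_eq_zero.1 this
  let α : F ⋙ evalAt s ⟶ (tensor R).obj N :=
    { app M := AddCommGrpCat.ofHom <| AddMonoidHom.mk'
        (fun x : (F.obj M).obj.obj s ↦ ((tensor R).obj N).map (lift M x) e)
        (fun x x' ↦ by
          refine (key (lift M (x + x')) (lift M x + lift M x') ?_).trans ?_
          · rw [hlift, F.map_add, Preadditive.comp_add]
            exact congrArg₂ (· + ·) (hlift M x).symm (hlift M x').symm
          · rw [Functor.map_add]
            rfl)
      naturality M M' φ := by
        ext x
        change ((tensor R).obj N).map (lift M' ((F.map φ).hom.app s x)) e =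
          ((tensor R).obj N).map φ (((tensor R).obj N).map (lift M x) e)
        rw [map_map_apply]
        apply key
        rw [hlift, F.map_comp, ← Category.assoc, reprEquiv_comp, hlift] }
  refine ⟨toNat.symm α, fun M φ ↦ ?_⟩
  rw [AddEquiv.apply_symm_apply]
  exact key _ _ (hlift M _)

/-- A natural transformation `Hom(P, F-) ⟶ N ⊗_R -` which vanishes on the kernel of
`Hom(P, F-) ⟶ Hom(Z, F-)`, where `Z` is a free module, comes from an element of
`(DF)N ⊗_S Z`. -/
lemma exists_evHom_sigma [F.Additive] [∀ ι : Type u, PreservesLimitsOfShape (Discrete ι) F]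
    {J : Type u} (t : J → S) {P : LeftMod S} (p : (∐ fun j ↦ repr (t j)) ⟶ P)
    (σ : ∀ M : LeftMod R, (P ⟶ F.obj M) → ((tensor R).obj N).obj M)
    (hσ : ∀ {M M' : LeftMod R} (h : P ⟶ F.obj M) (ψ : M ⟶ M'),
      σ M' (h ≫ F.map ψ) = ((tensor R).obj N).map ψ (σ M h))
    (hσp : ∀ (M : LeftMod R) (h : P ⟶ F.obj M), p ≫ h = 0 → σ M h = 0) :
    ∃ w : ((tensor S).obj ((dual F).obj N)).obj (∐ fun j ↦ repr (t j)),
      ∀ (M : LeftMod R) (h : P ⟶ F.obj M), evHom F N (p ≫ h) w = σ M h := by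
  classical
  choose A y hy using fun j ↦ exists_generator F (t j)
  let y' : (∐ fun j ↦ repr (t j)) ⟶ F.obj (∐ A) :=
    Sigma.desc fun j ↦ y j ≫ F.map (Sigma.ι A j)
  have hy' (j : J) {M : LeftMod R} (φ : (∐ A) ⟶ M) :
      Sigma.ι (fun j ↦ repr (t j)) j ≫ y' ≫ F.map φ = y j ≫ F.map (Sigma.ι A j ≫ φ) := by
    simp [y']
  -- `y'` generates `Hom(Z, F-)` for the free module `Z`; the square records the universal way in
  -- which `p ≫ h` is written as `y' ≫ F.map φ`.
  obtain ⟨B, φ₀, h₀, hB, hB'⟩ := exists_weakly_initial_square F p y'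
  -- In the cokernel of `φ₀` the map `p ≫ h₀` becomes zero, so `σ B h₀` dies there by `hσp`. The
  -- lift `e` will be the value of the extension on `y'`.
  obtain ⟨e, he⟩ := exists_tensor_map_eq N φ₀ (σ B h₀) (by
    rw [← hσ]
    apply hσp
    rw [reassoc_of% hB, ← F.map_comp, cokernel.condition, F.map_zero, comp_zero])
  have hφe {M : LeftMod R} (ψ : B ⟶ M) :
      ((tensor R).obj N).map (φ₀ ≫ ψ) e = σ M (h₀ ≫ F.map ψ) := by
    rw [hσ, ← he, map_map_apply]
  -- If `y j ≫ F.map φ = 0`, then `Sigma.π A j ≫ φ` and the zero map out of `P` form a square;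
  -- factoring it through `B` identifies the image of `e` with `σ M 0 = 0`.
  have hτ (j : J) := exists_toNat_app_generator (N := N) (y j) (hy j)
    (((tensor R).obj N).map (Sigma.π A j) e) (by
      intro M φ h
      rw [map_map_apply]
      obtain ⟨ψ, hψ, hψ'⟩ := hB' M (Sigma.π A j ≫ φ) 0 (by
        rw [comp_zero]
        refine (Sigma.hom_ext _ _ fun k ↦ ?_).symm
        rw [hy', comp_zero]
        by_cases hjk : k = j
        · subst hjk
          rw [← Category.assoc, Sigma.ι_π_eq_id, Category.id_comp, h]
        · rw [← Category.assoc, Sigma.ι_π_of_ne _ hjk, zero_comp, F.map_zero, comp_zero])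
      rw [← hψ, hφe, hψ']
      exact hσp _ _ comp_zero)
  choose τ hτ using hτ
  obtain ⟨s, hs⟩ := exists_sum_map_sigma ((tensor R).obj N) A e
  obtain ⟨v, hv⟩ : ∃ v : J → ((tensor S).obj ((dual F).obj N)).obj (∐ fun j ↦ repr (t j)),
      ∀ (j : J) (M : LeftMod R) (h : (∐ fun j ↦ repr (t j)) ⟶ F.obj M), evHom F N h (v j) =
        (toNat (τ j)).app M (reprEquiv _ _ (Sigma.ι (fun j ↦ repr (t j)) j ≫ h)) :=
    ⟨fun j ↦ tmul (t j) (τ j) (reprEquiv _ _ (Sigma.ι (fun j ↦ repr (t j)) j)),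
      fun j M h ↦ evHom_tmul F N h (t j) (τ j) _⟩
  -- `v j` is `τ j` tensored with the `j`-th basis element; only the finite support `s` of `e`
  -- contributes.
  refine ⟨∑ j ∈ s, v j, fun M h ↦ ?_⟩
  choose φ hφ using fun j ↦ hy j M (Sigma.ι (fun j ↦ repr (t j)) j ≫ p ≫ h)
  obtain ⟨ψ, hψ, hψ'⟩ := hB' M (Sigma.desc φ) h (Sigma.hom_ext _ _ fun j ↦ by
    rw [hy', Sigma.ι_desc, hφ])
  rw [map_sum, ← hψ', ← hφe, hψ]
  conv_rhs => rw [← hs, map_sum]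
  refine Finset.sum_congr rfl fun j _ ↦ ?_
  rw [hv, hψ', ← hφ, hτ, map_map_apply, map_map_apply, map_map_apply, Sigma.ι_desc]

end Extension

/-! ### Elements of `(DF)N ⊗_S A` as natural transformations on `Hom(A, F-)`. -/

section Representation
variable {R S : Type u} [SmallCategory R] [Preadditive R] [SmallCategory S] [Preadditive S]

/-- The direct sum of representable modules indexed by a family of elements of `A`. -/
abbrev freeOn {A : LeftMod S} (K : ∀ s : S, Set (A.obj.obj s)) : LeftMod S :=
  ∐ fun j : Σ s : S, K s ↦ repr j.1

/-- The map from the free module on a family of elements of `A`. -/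
def freeOnDesc {A : LeftMod S} (K : ∀ s : S, Set (A.obj.obj s)) : freeOn K ⟶ A :=
  Sigma.desc fun j ↦ (reprEquiv j.1 A).symm j.2.1

lemma exists_freeOnDesc_eq {A : LeftMod S} (K : ∀ s : S, Set (A.obj.obj s)) {s : S}
    {a : A.obj.obj s} (ha : a ∈ K s) : ∃ b, (freeOnDesc K).hom.app s b = a := by
  refine ⟨reprEquiv s _ (Sigma.ι (fun j : Σ s : S, K s ↦ repr j.1) ⟨s, a, ha⟩), ?_⟩
  rw [← reprEquiv_comp, freeOnDesc, Sigma.ι_desc, Equiv.apply_symm_apply]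

lemma freeOnDesc_comp_eq_zero {A M : LeftMod S} (K : ∀ s : S, Set (A.obj.obj s)) (g : A ⟶ M)
    (h : ∀ s, ∀ a ∈ K s, g.hom.app s a = 0) : freeOnDesc K ≫ g = 0 := by
  refine Sigma.hom_ext _ _ fun j ↦ (reprEquiv j.1 M).injective ?_
  rw [freeOnDesc, Sigma.ι_desc_assoc, reprEquiv_comp, Equiv.apply_symm_apply, comp_zero]
  exact h _ _ j.2.2

lemma eq_zero_of_freeOnDesc_comp {A M : LeftMod S} (K : ∀ s : S, Set (A.obj.obj s)) (g : A ⟶ M)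
    (h : freeOnDesc K ≫ g = 0) {s : S} {a : A.obj.obj s} (ha : a ∈ K s) : g.hom.app s a = 0 := by
  obtain ⟨b, rfl⟩ := exists_freeOnDesc_eq K ha
  exact ConcreteCategory.congr_hom (congrArg (fun f ↦ f.hom.app s) h) b

/-- A map which vanishes on the kernel of a surjective map factors through it. -/
lemma exists_factorization {P A M : LeftMod S} (q : P ⟶ A)
    (hq : ∀ s, Function.Surjective (q.hom.app s)) (h : P ⟶ M)
    (hh : ∀ (s : S) (x : P.obj.obj s), q.hom.app s x = 0 → h.hom.app s x = 0) :
    ∃ g : A ⟶ M, q ≫ g = h := by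
  choose l hl using hq
  have key {s : S} {x y : P.obj.obj s} (e : q.hom.app s x = q.hom.app s y) :
      h.hom.app s x = h.hom.app s y := by
    have := hh s (x - y) (by rw [map_sub, e, sub_self])
    rwa [map_sub, sub_eq_zero] at this
  refine ⟨ObjectProperty.homMk
    { app s := AddCommGrpCat.ofHom <| AddMonoidHom.mk' (fun a ↦ h.hom.app s (l s a))
        (fun a b ↦ by
          rw [← map_add]
          exact key (by rw [map_add, hl, hl, hl]))
      naturality s t f := by
        ext a
        refine Eq.trans ?_ (NatTrans.naturality_apply h.hom f _)
        exact key ((hl _ _).trans (by rw [NatTrans.naturality_apply q.hom, hl]; rfl)) }, ?_⟩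
  ext s x
  exact key (hl s _)

lemma tensor_map_surjective (X : RightMod S) {P A : LeftMod S} (q : P ⟶ A)
    (hq : ∀ s, Function.Surjective (q.hom.app s)) :
    Function.Surjective (((tensor S).obj X).map q) := by
  intro w
  induction w using tensorObj_induction with
  | zero => exact ⟨0, map_zero _⟩
  | tmul s n m =>
    obtain ⟨m, rfl⟩ := hq s m
    exact ⟨tmul s n m, tensor_obj_map_tmul X q s n m⟩
  | add z w hz hw =>
    obtain ⟨z, rfl⟩ := hz
    obtain ⟨w, rfl⟩ := hw
    exact ⟨z + w, map_add _ _ _⟩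

variable {F : LeftMod R ⥤ LeftMod S} [Functor.IsAccessible.{u} F] [F.Additive]
  [∀ ι : Type u, PreservesLimitsOfShape (Discrete ι) F] {N : RightMod R}

/-- Every natural transformation `Hom(A, F-) ⟶ N ⊗_R -` comes from `(DF)N ⊗_S A`. -/
lemma exists_evHom_eq {A : LeftMod S}
    (σ : ∀ M : LeftMod R, (A ⟶ F.obj M) → ((tensor R).obj N).obj M)
    (hσ : ∀ {M M' : LeftMod R} (h : A ⟶ F.obj M) (ψ : M ⟶ M'),
      σ M' (h ≫ F.map ψ) = ((tensor R).obj N).map ψ (σ M h))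
    (hσ₀ : ∀ M : LeftMod R, σ M 0 = 0) :
    ∃ w : ((tensor S).obj ((dual F).obj N)).obj A,
      ∀ (M : LeftMod R) (h : A ⟶ F.obj M), evHom F N h w = σ M h := by
  -- The free module on all elements covers `A`, so a map out of `A` killed by precomposition is
  -- zero. The element found over the cover is then pushed forward to `A`.
  obtain ⟨w, hw⟩ := exists_evHom_sigma _ (freeOnDesc fun s ↦ (Set.univ : Set (A.obj.obj s)))
    σ hσ (fun M h e ↦ by
      obtain rfl : h = 0 := by
        ext s x
        exact eq_zero_of_freeOnDesc_comp _ _ e (Set.mem_univ x)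
      exact hσ₀ M)
  refine ⟨((tensor S).obj ((dual F).obj N)).map (freeOnDesc _) w, fun M h ↦ ?_⟩
  rw [← hw, evHom_comp_apply]

/-- An element of `(DF)N ⊗_S A` is determined by its images in `N ⊗_R M` under
the maps `A ⟶ FM`. -/
lemma eq_of_evHom_eq {A : LeftMod S} (w w' : ((tensor S).obj ((dual F).obj N)).obj A)
    (hw : ∀ (M : LeftMod R) (h : A ⟶ F.obj M), evHom F N h w = evHom F N h w') : w = w' := by
  suffices ∀ w, (∀ (M : LeftMod R) (h : A ⟶ F.obj M), evHom F N h w = 0) → w = 0 from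
    sub_eq_zero.1 (this _ fun M h ↦ by rw [map_sub, hw, sub_self])
  clear hw w w'
  intro w hw
  let q := freeOnDesc fun s ↦ (Set.univ : Set (A.obj.obj s))
  have hq (s : S) : Function.Surjective (q.hom.app s) := fun a ↦
    exists_freeOnDesc_eq _ (Set.mem_univ a)
  obtain ⟨w₀, rfl⟩ := tensor_map_surjective _ q hq w
  -- A free cover of the kernel of `q`. A map `h` with `p ≫ h = 0` factors through `q`, where `hw`
  -- applies, so the transformation given by `w₀` comes from some `w₁` over this cover.
  let p := freeOnDesc fun s ↦ {x | q.hom.app s x = 0}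
  have hpq : p ≫ q = 0 := freeOnDesc_comp_eq_zero _ _ fun s x hx ↦ hx
  obtain ⟨w₁, hw₁⟩ := exists_evHom_sigma (F := F) (N := N) _ p (fun M h ↦ evHom F N h w₀)
    (fun h ψ ↦ by rw [evHom_map, ConcreteCategory.comp_apply])
    (fun M h e ↦ by
      obtain ⟨g, rfl⟩ := exists_factorization q hq h
        (fun s x hx ↦ eq_zero_of_freeOnDesc_comp _ _ e hx)
      rw [evHom_comp_apply]
      exact hw M g)
  -- Uniqueness over the free cover of `A` puts `w₀` in the image of `p`, which `q` kills.
  have : w₀ - ((tensor S).obj ((dual F).obj N)).map p w₁ = 0 :=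
    eq_zero_of_evHom_sigma F N _ _ fun M h ↦ by
      rw [map_sub, ← hw₁, evHom_comp_apply, sub_self]
  rw [sub_eq_zero.1 this, map_map_apply, hpq, Functor.map_zero]
  rfl

end Representation

/-! ### The universal property and the isomorphism of duals. -/

section Main
variable {R S T : Type u} [SmallCategory R] [Preadditive R] [SmallCategory S] [Preadditive S]
  [SmallCategory T] [Preadditive T]

section
variable (F : LeftMod R ⥤ LeftMod S) [Functor.IsAccessible.{u} F] (N : RightMod R)

/-- The map `Nat(Φ, (DF)N ⊗_S -) ⟶ Nat(ΦF, N ⊗_R -)`. -/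
def compHom (Φ : LeftMod S ⥤ AddCommGrpCat.{u}) :
    (Φ ⟶ (tensor S).obj ((dual F).obj N)) →+ (F ⋙ Φ ⟶ (tensor R).obj N) :=
  AddMonoidHom.mk' (fun β ↦ Functor.whiskerLeft F β ≫ ev F N) (fun β β' ↦ by
    rw [← Preadditive.add_comp]
    rfl)

lemma compHom_app (Φ : LeftMod S ⥤ AddCommGrpCat.{u})
    (β : Φ ⟶ (tensor S).obj ((dual F).obj N)) (M : LeftMod R) :
    (compHom F N Φ β).app M = β.app (F.obj M) ≫ (ev F N).app M := rfl

lemma app_evHom {Φ : LeftMod S ⥤ AddCommGrpCat.{u}}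
    (β : Φ ⟶ (tensor S).obj ((dual F).obj N)) {A : LeftMod S} {M : LeftMod R}
    (h : A ⟶ F.obj M) (g : Φ.obj A) :
    evHom F N h (β.app A g) = (compHom F N Φ β).app M (Φ.map h g) := by
  rw [compHom_app, ConcreteCategory.comp_apply, NatTrans.naturality_apply β]
  rfl

/-- The universal property of the Kan extension. By `app_evHom`, the element `β.app A g` must
represent `h ↦ γ.app M (Φ.map h g)`; such an element exists and is unique. -/
lemma compHom_bijective [F.Additive] [∀ ι : Type u, PreservesLimitsOfShape (Discrete ι) F]
    (Φ : LeftMod S ⥤ AddCommGrpCat.{u}) [Φ.Additive] :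
    Function.Bijective (compHom F N Φ) := by
  constructor
  · intro β β' e
    ext A g
    refine eq_of_evHom_eq _ _ fun M h ↦ ?_
    exact (app_evHom F N β h g).trans ((congrArg (fun γ : F ⋙ Φ ⟶ (tensor R).obj N ↦
      γ.app M (Φ.map h g)) e).trans (app_evHom F N β' h g).symm)
  · intro γ
    have hex (A : LeftMod S) (g : Φ.obj A) := exists_evHom_eq (F := F) (N := N) (A := A)
      (fun M h ↦ γ.app M (Φ.map h g))
      (fun {M M'} h ψ ↦ by
        refine Eq.trans ?_ (NatTrans.naturality_apply γ ψ _)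
        refine congrArg (γ.app M') ?_
        exact (map_map_apply Φ h (F.map ψ) g).symm)
      (fun M ↦ by
        rw [Φ.map_zero]
        exact map_zero _)
    choose b hb using hex
    -- Additivity and naturality of the chosen elements follow from their uniqueness.
    let β : Φ ⟶ (tensor S).obj ((dual F).obj N) :=
      { app A := AddCommGrpCat.ofHom <| AddMonoidHom.mk' (b A) (fun g g' ↦
          eq_of_evHom_eq _ _ fun M h ↦ by
            refine Eq.trans ?_ (map_add (evHom F N h).hom _ _).symm
            refine (hb _ _ M h).trans (Eq.trans ?_
              (congrArg₂ (· + ·) (hb _ g M h) (hb _ g' M h)).symm)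
            rw [map_add]
            exact map_add (γ.app M).hom _ _)
        naturality A A' f := by
          ext g
          change b A' (Φ.map f g) = ((tensor S).obj ((dual F).obj N)).map f (b A g)
          refine eq_of_evHom_eq _ _ fun M h ↦ ?_
          rw [hb, ← evHom_comp_apply, hb, map_map_apply] }
    refine ⟨β, ?_⟩
    ext M x
    -- Testing against the identity of `F.obj M` recovers `γ`.
    have := app_evHom F N β (𝟙 (F.obj M)) x
    rw [Φ.map_id] at this
    refine this.symm.trans ((hb _ x M (𝟙 _)).trans ?_)
    rw [Φ.map_id]
    rfl

lemma compHom_comp {Φ Ψ : LeftMod S ⥤ AddCommGrpCat.{u}} (θ : Ψ ⟶ Φ)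
    (β : Φ ⟶ (tensor S).obj ((dual F).obj N)) :
    compHom F N Ψ (θ ≫ β) = Functor.whiskerLeft F θ ≫ compHom F N Φ β := rfl

lemma ev_naturality {N N' : RightMod R} (a : N ⟶ N') :
    Functor.whiskerLeft F ((tensor S).map ((dual F).map a)) ≫ ev F N' =
      ev F N ≫ (tensor R).map a := by
  ext1
  ext1 M
  refine tensorObj_hom_ext fun s τ x ↦ ?_
  change (ev F N').app M (((tensor S).map ((dual F).map a)).app (F.obj M) (tmul s τ x)) =
    ((tensor R).map a).app M ((ev F N).app M (tmul s τ x))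
  rw [tensor_map_app_tmul, ev_app_tmul, ev_app_tmul, toNat_map_app]
  rfl

lemma compHom_map {Φ : LeftMod S ⥤ AddCommGrpCat.{u}} {N N' : RightMod R} (a : N ⟶ N')
    (β : Φ ⟶ (tensor S).obj ((dual F).obj N)) :
    compHom F N' Φ (β ≫ (tensor S).map ((dual F).map a)) =
      compHom F N Φ β ≫ (tensor R).map a := by
  change Functor.whiskerLeft F (β ≫ (tensor S).map ((dual F).map a)) ≫ ev F N' =
    (Functor.whiskerLeft F β ≫ ev F N) ≫ (tensor R).map a
  rw [Functor.whiskerLeft_comp, Category.assoc, ev_naturality, Category.assoc]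

end

variable (F : LeftMod R ⥤ LeftMod S) (G : LeftMod S ⥤ LeftMod T) [F.Additive] [G.Additive]
  [Functor.IsAccessible.{u} F] [Functor.IsAccessible.{u} G]

instance (t : T) : (evalAt (R := T) t).Additive where
  map_add := rfl

/-- The group `((DG)(DF)N)(t)` is isomorphic to `(D(GF)N)(t)`. -/
def dualCompEquiv [∀ ι : Type u, PreservesLimitsOfShape (Discrete ι) F] (N : RightMod R) (t : T) :
    ((dual G).obj ((dual F).obj N)).obj.obj (op t) ≃+ ((dual (F ⋙ G)).obj N).obj.obj (op t) :=
  toNat.trans ((AddEquiv.ofBijective (compHom F N (G ⋙ evalAt t))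
    (compHom_bijective F N (G ⋙ evalAt t))).trans (toNat (F := F ⋙ G)).symm)

lemma toNat_dualCompEquiv [∀ ι : Type u, PreservesLimitsOfShape (Discrete ι) F] (N : RightMod R)
    (t : T) (τ : ((dual G).obj ((dual F).obj N)).obj.obj (op t)) :
    toNat (F := F ⋙ G) (dualCompEquiv F G N t τ) = compHom F N (G ⋙ evalAt t) (toNat τ) :=
  (toNat (F := F ⋙ G)).apply_symm_apply _

/-- The isomorphism `(DG)(DF) ≅ D(GF)` for accessible additive functors `F` and `G` such that
`F` preserves products. -/
def dualCompIso [∀ ι : Type u, PreservesLimitsOfShape (Discrete ι) F] :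
    dual F ⋙ dual G ≅ dual (F ⋙ G) :=
  NatIso.ofComponents
    (fun N ↦ ObjectProperty.isoMk _ (NatIso.ofComponents
      (fun t ↦ (dualCompEquiv F G N t.unop).toAddCommGrpIso) (fun {t t'} f ↦ by
        ext τ
        apply (toNat (F := F ⋙ G)).injective
        change toNat (F := F ⋙ G) (dualCompEquiv F G N t'.unop
            (((dual G).obj ((dual F).obj N)).obj.map f.unop.op τ)) =
          toNat (F := F ⋙ G) (((dual (F ⋙ G)).obj N).obj.map f.unop.op
            (dualCompEquiv F G N t.unop τ))
        rw [toNat_dualCompEquiv, toNat_obj_map, toNat_obj_map, toNat_dualCompEquiv, compHom_comp]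
        rfl)))
    (fun {N N'} a ↦ by
      ext t τ
      apply (toNat (F := F ⋙ G)).injective
      change toNat (F := F ⋙ G) (dualCompEquiv F G N' t.unop
          (((dual G).map ((dual F).map a)).hom.app (op t.unop) τ)) =
        toNat (F := F ⋙ G) (((dual (F ⋙ G)).map a).hom.app (op t.unop)
          (dualCompEquiv F G N t.unop τ))
      rw [toNat_dualCompEquiv, toNat_map_app, toNat_map_app, toNat_dualCompEquiv, compHom_map])

end Main

end AGJ
end

theorem mainTheorem7 {R S T : Type u} [SmallCategory R] [Preadditive R]
    [SmallCategory S] [Preadditive S] [SmallCategory T] [Preadditive T]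
    (F : AGJ.LeftMod R ⥤ AGJ.LeftMod S) (G : AGJ.LeftMod S ⥤ AGJ.LeftMod T)
    [F.Additive] [G.Additive] [AGJ.PreservesDirectedColimits F] [AGJ.PreservesDirectedColimits G]
    [∀ ι : Type u, PreservesLimitsOfShape (Discrete ι) F] :
    Nonempty (AGJ.dual F ⋙ AGJ.dual G ≅ AGJ.dual (F ⋙ G)) := by
  exact ⟨AGJ.dualCompIso F G⟩
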